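/- Let $\mathscr{A}=\bigoplus_{n\in\mathbb{Z}}\mathscr{A}_{(n)}$ be a $\mathbb{Z}$-graded unital complex $*$-algebra such that $x^*\in\mathscr{A}_{(-n)}$ whenever $x\in\mathscr{A}_{(n)}$, and for $w\in S^1$ let $\sigma_w:\mathscr{A}\to\mathscr{A}$ be the $*$-automorphism with $\sigma_w(x)=w^{-n}x$ for $x\in\mathscr{A}_{(n)}$, $n\in\mathbb{Z}$. Let $\|\cdot\|$ and $\|\cdot\|'$ be two $C^*$-norms on $\mathscr{A}$ with $\|\sigma_w(x)\|\le\|x\|$ and $\|\sigma_w(x)\|'\le\|x\|'$ for all $w\in S^1$, $x\in\mathscr{A}$. Let $A$ and $A'$ be the corresponding $C^*$-completions, and let $\{\sigma_w\}$ and $\{\sigma'_w\}$ also denote the strongly continuous circle actions on $A$ and $A'$ obtained by extending the $\sigma_w$ by continuity. For a strongly continuous circle action $\{\sigma_w\}$ on a $C^*$-algebra $A$ put $A_{(n)}=\{\xi\in A:\sigma_w(\xi)=w^{-n}\xi\text{ for all }w\in S^1\}$, a right Hilbert $C^*$-module over the $C^*$-algebra $A_{(0)}$ with inner product $\langle\xi,\eta\rangle=\xi^*\eta$.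 Say that the action satisfies condition (S) if $A_{(0)}$ is separable and both $A_{(1)}$ and $A_{(-1)}$ are full and countably generated over $A_{(0)}$; here $A_{(n)}$ is full if the linear span of $\{\xi^*\eta:\xi,\eta\in A_{(n)}\}$ is dense in $A_{(0)}$, and countably generated if there is a countable $S\subseteq A_{(n)}$ such that the linear span of $\{\xi a:\xi\in S,\ a\in A_{(0)}\}$ is dense in $A_{(n)}$. Suppose that $\|x\|=\|x\|'$ for all $x\in\mathscr{A}_{(0)}$. Then the action $\{\sigma_w\}$ on $A$ satisfies (S) if and only if the action $\{\sigma'_w\}$ on $A'$ satisfies (S). In this case the identity map $\mathscr{A}\to\mathscr{A}$ induces an isomorphism $A\to A'$ of $C^*$-algebras; in particular $\|x\|=\|x\|'$ for all $x\in\mathscr{A}$. -/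

import Mathlib

open UniformSpace

noncomputable section

/-! ### Circle actions on C⋆-algebras -/

/-- A strongly continuous action of the circle group on a C⋆-algebra by ⋆-automorphisms. -/
structure CircleAction (A : Type*) [NonUnitalCStarAlgebra A] where
  /-- the ⋆-automorphism attached to a point of the circle -/
  aut : Circle →* (A ≃⋆ₐ[ℂ] A)
  /-- strong continuity -/
  continuous_apply : ∀ a : A, Continuous fun z : Circle => aut z a

namespace CircleAction

variable {A : Type*} [NonUnitalCStarAlgebra A] (σ : CircleAction A)

/-- The spectral subspace `A₍ₙ₎ = {ξ | σ_z ξ = z⁻ⁿ ξ for all z}`. -/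
def spectralSubspace (n : ℤ) : Submodule ℂ A where
  carrier := {ξ | ∀ z : Circle, σ.aut z ξ = ((z : ℂ) ^ (-n)) • ξ}
  add_mem' := by
    intro a b ha hb z
    rw [map_add, ha z, hb z, smul_add]
  zero_mem' := by
    intro z
    rw [map_zero, smul_zero]
  smul_mem' := by
    intro c a ha z
    rw [map_smul, ha z, smul_comm]

/-- The right Hilbert C⋆-module `A₍ₙ₎` over `A₍₀₎`, with inner product `⟨ξ, η⟩ = ξ* η`, is full:
the linear span of the inner products is dense in `A₍₀₎`. -/
def IsFull (n : ℤ) : Prop :=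
  closure (Submodule.span ℂ {a : A | ∃ ξ ∈ σ.spectralSubspace n, ∃ η ∈ σ.spectralSubspace n,
    a = star ξ * η} : Set A) = (σ.spectralSubspace 0 : Set A)

/-- The right Hilbert C⋆-module `A₍ₙ₎` is countably generated over `A₍₀₎`: there is a countable
subset `S` of `A₍ₙ₎` such that the linear span of `S · A₍₀₎` is dense in `A₍ₙ₎`. -/
def IsCountablyGenerated (n : ℤ) : Prop :=
  ∃ S : Set A, S.Countable ∧ S ⊆ (σ.spectralSubspace n : Set A) ∧
    closure (Submodule.span ℂ {b : A | ∃ ξ ∈ S, ∃ a ∈ σ.spectralSubspace 0, b = ξ * a} : Set A) =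
      (σ.spectralSubspace n : Set A)

/-- The standing conditions on a circle action: `A₍₀₎` is separable, and the Hilbert C⋆-modules
`A₍₁₎` and `A₍₋₁₎` are full and countably generated over `A₍₀₎`. -/
structure FullSpectral : Prop where
  separable : TopologicalSpace.SeparableSpace (σ.spectralSubspace 0)
  full_one : σ.IsFull 1
  full_neg_one : σ.IsFull (-1)
  countablyGenerated_one : σ.IsCountablyGenerated 1
  countablyGenerated_neg_one : σ.IsCountablyGenerated (-1)

end CircleAction

/-! ### C⋆-norms on ⋆-algebras and their completions -/

/-- A C⋆-norm on a complex ⋆-algebra: a submultiplicative complex algebra norm satisfying the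
C⋆-identity. -/
structure CStarNorm (𝒜 : Type*) [Ring 𝒜] [Algebra ℂ 𝒜] [StarRing 𝒜] extends RingNorm 𝒜 where
  norm_smul' : ∀ (c : ℂ) (x : 𝒜), toFun (c • x) = ‖c‖ * toFun x
  norm_star_mul_self' : ∀ x : 𝒜, toFun (star x * x) = toFun x ^ 2

namespace CStarNorm

variable {𝒜 : Type*} [Ring 𝒜] [Algebra ℂ 𝒜] [StarRing 𝒜]

instance : CoeFun (CStarNorm 𝒜) fun _ => 𝒜 → ℝ := ⟨fun N => N.toFun⟩

/-- The algebra `𝒜`, regarded as a normed algebra through the C⋆-norm `N`. -/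
@[nolint unusedArguments]
def Carrier (_N : CStarNorm 𝒜) : Type _ := 𝒜

variable (N : CStarNorm 𝒜)

instance : NormedRing N.Carrier := N.toRingNorm.toNormedRing

instance : StarRing N.Carrier := inferInstanceAs (StarRing 𝒜)

instance : Algebra ℂ N.Carrier := inferInstanceAs (Algebra ℂ 𝒜)

instance : NormedAlgebra ℂ N.Carrier where
  norm_smul_le c x := (N.norm_smul' c x).le

instance [StarModule ℂ 𝒜] : StarModule ℂ N.Carrier := inferInstanceAs (StarModule ℂ 𝒜)

theorem norm_carrier (x : N.Carrier) : ‖x‖ = N x := rfl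

instance : CStarRing N.Carrier where
  norm_mul_self_le x := by
    have h : ‖star x * x‖ = ‖x‖ ^ 2 := N.norm_star_mul_self' x
    rw [h, sq]

/-- The completion of `𝒜` with respect to the C⋆-norm `N`. -/
abbrev Completion : Type _ := UniformSpace.Completion N.Carrier

/-- The canonical map of `𝒜` into its completion. -/
def toCompletion (x : 𝒜) : N.Completion := ((show N.Carrier from x : N.Carrier) : N.Completion)

/-- The involution of the completion, the continuous extension of that of `𝒜`. -/
instance : Star N.Completion := ⟨Completion.map (star : N.Carrier → N.Carrier)⟩

theorem star_coe (x : N.Carrier) : star (x : N.Completion) = ((star x : N.Carrier) : N.Completion) :=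
  Completion.map_coe star_isometry.uniformContinuous x

theorem continuous_star_completion : Continuous (star : N.Completion → N.Completion) :=
  Completion.continuous_map

instance : StarRing N.Completion where
  star_involutive x := by
    have hc := N.continuous_star_completion
    induction x using Completion.induction_on with
    | hp => exact isClosed_eq (hc.comp hc) continuous_id
    | ih x => rw [star_coe, star_coe, star_star]
  star_mul x y := by
    have hc := N.continuous_star_completion
    induction x, y using Completion.induction_on₂ with
    | hp => exact isClosed_eq (hc.comp (continuous_fst.mul continuous_snd))
              ((hc.comp continuous_snd).mul (hc.comp continuous_fst))
    | ih x y => rw [← Completion.coe_mul, star_coe, star_coe, star_coe, star_mul,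
                  Completion.coe_mul]
  star_add x y := by
    have hc := N.continuous_star_completion
    induction x, y using Completion.induction_on₂ with
    | hp => exact isClosed_eq (hc.comp (continuous_fst.add continuous_snd))
              ((hc.comp continuous_fst).add (hc.comp continuous_snd))
    | ih x y => rw [← Completion.coe_add, star_coe, star_coe, star_coe, star_add,
                  Completion.coe_add]

instance : CStarRing N.Completion where
  norm_mul_self_le x := by
    have hc := N.continuous_star_completion
    induction x using Completion.induction_on with
    | hp => exact isClosed_le (continuous_norm.mul continuous_norm)
              (continuous_norm.comp (hc.mul continuous_id))
    | ih x => rw [star_coe, ← Completion.coe_mul, Completion.norm_coe, Completion.norm_coe,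
                CStarRing.norm_star_mul_self]

instance [StarModule ℂ 𝒜] : StarModule ℂ N.Completion where
  star_smul c x := by
    have hc := N.continuous_star_completion
    induction x using Completion.induction_on with
    | hp => exact isClosed_eq (hc.comp (continuous_const_smul c)) (hc.const_smul (star c))
    | ih x => rw [← Completion.coe_smul, star_coe, star_coe, star_smul, Completion.coe_smul]

/-- The completion of a unital ⋆-algebra in a C⋆-norm is a unital C⋆-algebra. -/
instance [StarModule ℂ 𝒜] : CStarAlgebra N.Completion where
  norm_smul_le := norm_smul_le

end CStarNorm

/-! ### The circle action of a `ℤ`-grading -/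

section Rotation

variable {𝒜 : Type*} [Ring 𝒜] [Algebra ℂ 𝒜]
variable (gr : ℤ → Submodule ℂ 𝒜) [GradedAlgebra gr]

/-- The map `σ_w` of a `ℤ`-graded algebra, which is multiplication by `w⁻ⁿ` on the component of
degree `n`. -/
def gradedRotation (w : Circle) : 𝒜 →ₗ[ℂ] 𝒜 :=
  (DirectSum.toModule ℂ ℤ 𝒜 fun n => ((w : ℂ) ^ (-n)) • (gr n).subtype) ∘ₗ
    (DirectSum.decomposeLinearEquiv gr).toLinearMap

theorem gradedRotation_of_mem (w : Circle) {n : ℤ} {x : 𝒜} (hx : x ∈ gr n) :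
    gradedRotation gr w x = ((w : ℂ) ^ (-n)) • x := by
  simp only [gradedRotation, LinearMap.comp_apply, LinearEquiv.coe_coe,
    DirectSum.decomposeLinearEquiv_apply]
  lift x to gr n using hx
  rw [DirectSum.decompose_coe, ← DirectSum.lof_eq_of ℂ, DirectSum.toModule_lof]
  simp

theorem gradedRotation_mem (w : Circle) {n : ℤ} {x : 𝒜} (hx : x ∈ gr n) :
    gradedRotation gr w x ∈ gr n := by
  rw [gradedRotation_of_mem gr w hx]
  exact (gr n).smul_mem _ hx

theorem gradedRotation_mul (w : Circle) (x y : 𝒜) :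
    gradedRotation gr w (x * y) = gradedRotation gr w x * gradedRotation gr w y := by
  induction x using DirectSum.Decomposition.inductionOn gr with
  | zero => simp
  | add a b ha hb => rw [add_mul, map_add, ha, hb, map_add, add_mul]
  | @homogeneous i a =>
    induction y using DirectSum.Decomposition.inductionOn gr with
    | zero => simp
    | add c d hc hd => rw [mul_add, map_add, hc, hd, map_add, mul_add]
    | @homogeneous j c =>
      rw [gradedRotation_of_mem gr w a.2, gradedRotation_of_mem gr w c.2,
        gradedRotation_of_mem gr w (SetLike.mul_mem_graded a.2 c.2), smul_mul_smul_comm,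
        ← zpow_add₀ (Circle.coe_ne_zero w), neg_add]

theorem gradedRotation_star [StarRing 𝒜] [StarModule ℂ 𝒜]
    (hstar : ∀ (n : ℤ) (x : 𝒜), x ∈ gr n → star x ∈ gr (-n)) (w : Circle) (x : 𝒜) :
    gradedRotation gr w (star x) = star (gradedRotation gr w x) := by
  induction x using DirectSum.Decomposition.inductionOn gr with
  | zero => simp
  | add a b ha hb => rw [star_add, map_add, ha, hb, map_add, star_add]
  | @homogeneous i a =>
    rw [gradedRotation_of_mem gr w a.2, gradedRotation_of_mem gr w (hstar i _ a.2), star_smul,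
      star_zpow₀]
    congr 1
    have h : star (w : ℂ) = (w : ℂ)⁻¹ := by
      rw [← Circle.coe_inv, Circle.coe_inv_eq_conj]
      rfl
    rw [h, inv_zpow']

theorem gradedRotation_comp (v w : Circle) (x : 𝒜) :
    gradedRotation gr (v * w) x = gradedRotation gr v (gradedRotation gr w x) := by
  induction x using DirectSum.Decomposition.inductionOn gr with
  | zero => simp
  | add a b ha hb => simp only [map_add, ha, hb]
  | @homogeneous i a =>
    rw [gradedRotation_of_mem gr v (gradedRotation_mem gr w a.2),
      gradedRotation_of_mem gr w a.2, gradedRotation_of_mem gr _ a.2, smul_smul,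
      Circle.coe_mul, mul_zpow]

theorem gradedRotation_one (x : 𝒜) : gradedRotation gr 1 x = x := by
  induction x using DirectSum.Decomposition.inductionOn gr with
  | zero => simp
  | add a b ha hb => simp only [map_add, ha, hb]
  | @homogeneous i a => rw [gradedRotation_of_mem gr _ a.2]; simp

end Rotation

namespace CStarNorm

variable {𝒜 : Type*} [Ring 𝒜] [Algebra ℂ 𝒜] [StarRing 𝒜]
variable (gr : ℤ → Submodule ℂ 𝒜) [GradedAlgebra gr] (N : CStarNorm 𝒜)

/-- `σ_w` as a map on the normed algebra `(𝒜, N)`. -/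
def rotation (w : Circle) (x : N.Carrier) : N.Carrier := gradedRotation gr w (x : 𝒜)

/-- The norm `N` does not increase under the circle action of the grading. -/
def IsCircleInvariant : Prop :=
  ∀ (w : Circle) (x : 𝒜), N (gradedRotation gr w x) ≤ N x

variable {gr N}

theorem uniformContinuous_rotation (hN : N.IsCircleInvariant gr) (w : Circle) :
    UniformContinuous (N.rotation gr w) := by
  have h : LipschitzWith 1 (N.rotation gr w) := by
    refine LipschitzWith.of_dist_le_mul fun x y => ?_
    rw [dist_eq_norm, dist_eq_norm, NNReal.coe_one, one_mul]
    have e : N.rotation gr w x - N.rotation gr w y = N.rotation gr w (x - y) :=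
      ((gradedRotation gr w).map_sub _ _).symm
    rw [e]
    exact hN w (x - y)
  exact h.uniformContinuous

variable (gr N)

/-- The extension by continuity of `σ_w` to the completion of `𝒜` in the norm `N`. -/
def completionRotation (w : Circle) : N.Completion → N.Completion :=
  Completion.map (N.rotation gr w)

theorem continuous_completionRotation (w : Circle) : Continuous (N.completionRotation gr w) :=
  Completion.continuous_map

variable {gr N}

theorem completionRotation_coe (hN : N.IsCircleInvariant gr) (w : Circle) (x : N.Carrier) :
    N.completionRotation gr w (x : N.Completion) = ((N.rotation gr w x : N.Carrier) : N.Completion) :=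
  Completion.map_coe (uniformContinuous_rotation hN w) x

theorem completionRotation_comp (hN : N.IsCircleInvariant gr) (v w : Circle) (x : N.Completion) :
    N.completionRotation gr (v * w) x =
      N.completionRotation gr v (N.completionRotation gr w x) := by
  have hc := N.continuous_completionRotation gr
  induction x using Completion.induction_on with
  | hp => exact isClosed_eq (hc _) ((hc v).comp (hc w))
  | ih x =>
    rw [completionRotation_coe hN, completionRotation_coe hN, completionRotation_coe hN]
    exact congrArg _ (gradedRotation_comp gr v w x)

theorem completionRotation_one (hN : N.IsCircleInvariant gr) (x : N.Completion) :
    N.completionRotation gr 1 x = x := by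
  have hc := N.continuous_completionRotation gr
  induction x using Completion.induction_on with
  | hp => exact isClosed_eq (hc _) continuous_id
  | ih x =>
    rw [completionRotation_coe hN]
    exact congrArg _ (gradedRotation_one gr x)

theorem completionRotation_norm_le (hN : N.IsCircleInvariant gr) (w : Circle) (x : N.Completion) :
    ‖N.completionRotation gr w x‖ ≤ ‖x‖ := by
  have hc := N.continuous_completionRotation gr
  induction x using Completion.induction_on with
  | hp => exact isClosed_le (continuous_norm.comp (hc _)) continuous_norm
  | ih x =>
    rw [completionRotation_coe hN, Completion.norm_coe, Completion.norm_coe]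
    exact hN w x

theorem completionRotation_add (hN : N.IsCircleInvariant gr) (w : Circle) (x y : N.Completion) :
    N.completionRotation gr w (x + y) =
      N.completionRotation gr w x + N.completionRotation gr w y := by
  have hc := N.continuous_completionRotation gr w
  induction x, y using Completion.induction_on₂ with
  | hp => exact isClosed_eq (hc.comp (continuous_fst.add continuous_snd))
            ((hc.comp continuous_fst).add (hc.comp continuous_snd))
  | ih x y =>
    rw [← Completion.coe_add, completionRotation_coe hN, completionRotation_coe hN,
      completionRotation_coe hN, ← Completion.coe_add]
    exact congrArg _ ((gradedRotation gr w).map_add x y)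

theorem completionRotation_mul (hN : N.IsCircleInvariant gr) (w : Circle) (x y : N.Completion) :
    N.completionRotation gr w (x * y) =
      N.completionRotation gr w x * N.completionRotation gr w y := by
  have hc := N.continuous_completionRotation gr w
  induction x, y using Completion.induction_on₂ with
  | hp => exact isClosed_eq (hc.comp (continuous_fst.mul continuous_snd))
            ((hc.comp continuous_fst).mul (hc.comp continuous_snd))
  | ih x y =>
    rw [← Completion.coe_mul, completionRotation_coe hN, completionRotation_coe hN,
      completionRotation_coe hN, ← Completion.coe_mul]
    exact congrArg _ (gradedRotation_mul gr w x y)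

theorem completionRotation_smul (hN : N.IsCircleInvariant gr) (w : Circle) (c : ℂ)
    (x : N.Completion) :
    N.completionRotation gr w (c • x) = c • N.completionRotation gr w x := by
  have hc := N.continuous_completionRotation gr w
  induction x using Completion.induction_on with
  | hp => exact isClosed_eq (hc.comp (continuous_const_smul c)) (hc.const_smul c)
  | ih x =>
    rw [← Completion.coe_smul, completionRotation_coe hN, completionRotation_coe hN,
      ← Completion.coe_smul]
    exact congrArg _ ((gradedRotation gr w).map_smul c x)

theorem completionRotation_star [StarModule ℂ 𝒜]
    (hstar : ∀ (n : ℤ) (x : 𝒜), x ∈ gr n → star x ∈ gr (-n))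
    (hN : N.IsCircleInvariant gr) (w : Circle) (x : N.Completion) :
    N.completionRotation gr w (star x) = star (N.completionRotation gr w x) := by
  have hc := N.continuous_completionRotation gr w
  have hs := N.continuous_star_completion
  induction x using Completion.induction_on with
  | hp => exact isClosed_eq (hc.comp hs) (hs.comp hc)
  | ih x =>
    rw [star_coe, completionRotation_coe hN, completionRotation_coe hN, star_coe]
    exact congrArg _ (gradedRotation_star gr hstar w x)

theorem continuous_rotation (x : N.Carrier) : Continuous fun w : Circle => N.rotation gr w x := by
  refine DirectSum.Decomposition.inductionOn gr
    (motive := fun x : 𝒜 => Continuous fun w : Circle => N.rotation gr w x) ?_ ?_ ?_ x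
  · have e : (fun w : Circle => N.rotation gr w (0 : 𝒜)) = fun _ => (0 : N.Carrier) :=
      funext fun w => (gradedRotation gr w).map_zero
    rw [e]
    exact continuous_const
  · intro i a
    have e : (fun w : Circle => N.rotation gr w (a : 𝒜)) =
        fun w : Circle => ((w : ℂ) ^ (-i)) • (show N.Carrier from (a : 𝒜)) :=
      funext fun w => gradedRotation_of_mem gr w a.2
    rw [e]
    refine Continuous.smul ?_ continuous_const
    exact continuous_subtype_val.zpow₀ (-i) fun w => Or.inl (Circle.coe_ne_zero w)
  · intro a b ha hb
    have e : (fun w : Circle => N.rotation gr w (a + b : 𝒜)) =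
        fun w : Circle => N.rotation gr w a + N.rotation gr w b :=
      funext fun w => (gradedRotation gr w).map_add a b
    rw [e]
    exact ha.add hb

theorem continuous_completionRotation_apply (hN : N.IsCircleInvariant gr) (x : N.Completion) :
    Continuous fun w : Circle => N.completionRotation gr w x := by
  rw [Metric.continuous_iff']
  intro w ε hε
  obtain ⟨y, hy⟩ := Completion.denseRange_coe.exists_dist_lt x (by positivity : 0 < ε / 3)
  have hcy : Continuous fun w : Circle => N.completionRotation gr w (y : N.Completion) := by
    simp only [completionRotation_coe hN]
    exact (Completion.continuous_coe _).comp (continuous_rotation y)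
  have hle (v : Circle) (a b : N.Completion) :
      dist (N.completionRotation gr v a) (N.completionRotation gr v b) ≤ dist a b := by
    have e : N.completionRotation gr v a =
        N.completionRotation gr v (a - b) + N.completionRotation gr v b := by
      rw [← completionRotation_add hN, sub_add_cancel]
    rw [dist_eq_norm, dist_eq_norm, e, add_sub_cancel_right]
    exact completionRotation_norm_le hN v _
  filter_upwards [Metric.continuous_iff'.1 hcy w (ε / 3) (by positivity)] with v hv
  have h1 := hle v x y
  have h2 := hle w y x
  rw [dist_comm (y : N.Completion) x] at h2
  have h3 := dist_triangle4 (N.completionRotation gr v x) (N.completionRotation gr v y)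
    (N.completionRotation gr w y) (N.completionRotation gr w x)
  linarith

/-- The circle action on the completion of `𝒜` in a circle invariant C⋆-norm `N`: the extension by
continuity of the action `σ` on `𝒜` given by the grading. -/
def circleAction [StarModule ℂ 𝒜] (hstar : ∀ (n : ℤ) (x : 𝒜), x ∈ gr n → star x ∈ gr (-n))
    (hN : N.IsCircleInvariant gr) : CircleAction N.Completion where
  aut :=
    { toFun := fun w =>
        { toFun := N.completionRotation gr w
          invFun := N.completionRotation gr w⁻¹
          left_inv := fun x => by
            rw [← completionRotation_comp hN, inv_mul_cancel, completionRotation_one hN]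
          right_inv := fun x => by
            rw [← completionRotation_comp hN, mul_inv_cancel, completionRotation_one hN]
          map_mul' := completionRotation_mul hN w
          map_add' := completionRotation_add hN w
          map_star' := completionRotation_star hstar hN w
          map_smul' := completionRotation_smul hN w }
      map_one' := StarAlgEquiv.ext fun x => completionRotation_one hN x
      map_mul' := fun v w => StarAlgEquiv.ext fun x => completionRotation_comp hN v w x }
  continuous_apply := continuous_completionRotation_apply hN

end CStarNorm

end

/-! The two norms are already equal on the graded algebra, so both completions and both actions
coincide. By the C⋆-identity, agreement in degree zero gives agreement on every homogeneous element,
since `star x * x` then has degree zero (`eq_of_mem`). Circle invariance makes the projections onto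
homogeneous components contractive (`proj_le_of_mem_gradedBand`), so an element with degrees in
`[-m, m]` satisfies `N x ≤ (2 * m + 1) * N' x` (`le_mul_of_mem_gradedBand`).

The factor is removed by a power trick. For `y = star x * x` the C⋆-identity gives `N (y ^ 2 ^ j) =
N y ^ 2 ^ j`, while the degrees of `y ^ 2 ^ j` spread only linearly in the exponent. A linear factor
disappears on taking roots of order `2 ^ j`, whence `N ≤ N'` (`le_of_eq_on_zero`); the reverse
inequality follows by symmetry. -/

/-! ### Elements of bounded degree and their homogeneous components -/

/-- The elements of a `ℤ`-graded algebra whose components all have degree in `[-m, m]`. -/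
def gradedBand {𝒜 : Type*} [Ring 𝒜] [Algebra ℂ 𝒜] (gr : ℤ → Submodule ℂ 𝒜) (m : ℕ) :
    Submodule ℂ 𝒜 :=
  ⨆ i : Finset.Icc (-(m : ℤ)) m, gr i

section GradedBand

variable {𝒜 : Type*} [Ring 𝒜] [Algebra ℂ 𝒜] {gr : ℤ → Submodule ℂ 𝒜}

theorem mem_gradedBand_of_mem {m : ℕ} {i : ℤ} (hi : i ∈ Finset.Icc (-(m : ℤ)) m) {x : 𝒜}
    (hx : x ∈ gr i) : x ∈ gradedBand gr m :=
  Submodule.mem_iSup_of_mem (p := fun i : Finset.Icc (-(m : ℤ)) m => gr i) ⟨i, hi⟩ hx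

theorem gradedBand_mono : Monotone (gradedBand gr) := by
  intro m k hmk
  refine iSup_le fun i x hx => mem_gradedBand_of_mem ?_ hx
  have := Finset.mem_Icc.1 i.2
  exact Finset.mem_Icc.2 (by omega)

variable [GradedAlgebra gr]

theorem mul_mem_gradedBand {m k : ℕ} {x y : 𝒜} (hx : x ∈ gradedBand gr m)
    (hy : y ∈ gradedBand gr k) : x * y ∈ gradedBand gr (m + k) := by
  refine Submodule.iSup_induction _ (motive := fun x => x * y ∈ gradedBand gr (m + k)) hx
    (fun i a ha => ?_) (by simp) fun a b ha hb => by rw [add_mul]; exact add_mem ha hb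
  refine Submodule.iSup_induction _ (motive := fun y => a * y ∈ gradedBand gr (m + k)) hy
    (fun j b hb => ?_) (by simp) fun c d hc hd => by rw [mul_add]; exact add_mem hc hd
  refine mem_gradedBand_of_mem ?_ (SetLike.mul_mem_graded ha hb)
  have hi := Finset.mem_Icc.1 i.2
  have hj := Finset.mem_Icc.1 j.2
  exact Finset.mem_Icc.2 (by push_cast; omega)

/-- Degrees add under multiplication. The linear growth of the band in `n` is what makes the power
trick work. -/
theorem pow_mem_gradedBand {m : ℕ} {x : 𝒜} (hx : x ∈ gradedBand gr m) (n : ℕ) :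
    x ^ n ∈ gradedBand gr (n * m) := by
  induction n with
  | zero =>
    rw [pow_zero]
    exact mem_gradedBand_of_mem (by simp) (SetLike.one_mem_graded gr)
  | succ n ih =>
    rw [pow_succ, add_one_mul]
    exact mul_mem_gradedBand ih hx

variable (gr) in
theorem exists_mem_gradedBand (x : 𝒜) : ∃ m : ℕ, x ∈ gradedBand gr m := by
  induction x using DirectSum.Decomposition.inductionOn gr with
  | zero => exact ⟨0, zero_mem _⟩
  | @homogeneous i a =>
    exact ⟨i.natAbs, mem_gradedBand_of_mem (Finset.mem_Icc.2 (by omega)) a.2⟩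
  | add a b ha hb =>
    obtain ⟨m, hm⟩ := ha
    obtain ⟨k, hk⟩ := hb
    exact ⟨max m k, add_mem (gradedBand_mono (le_max_left m k) hm)
      (gradedBand_mono (le_max_right m k) hk)⟩

theorem sum_proj_eq_of_mem_gradedBand {m : ℕ} {x : 𝒜} (hx : x ∈ gradedBand gr m) :
    ∑ n ∈ Finset.Icc (-(m : ℤ)) m, GradedRing.proj gr n x = x := by
  refine Submodule.iSup_induction _
    (motive := fun x => ∑ n ∈ Finset.Icc (-(m : ℤ)) m, GradedRing.proj gr n x = x) hx
    (fun i a ha => ?_) (by simp) fun a b ha hb => by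
      simp only [map_add, Finset.sum_add_distrib, ha, hb]
  rw [Finset.sum_eq_single_of_mem (i : ℤ) i.2]
  · rw [GradedRing.proj_apply, DirectSum.decompose_of_mem_same gr ha]
  · intro n _ hn
    rw [GradedRing.proj_apply, DirectSum.decompose_of_mem_ne gr ha hn.symm]

/-- On elements with degrees in `[-m, m]`, the components are averages of the rotations over the
roots of unity of order `2 * m + 1`. -/
theorem sum_gradedRotation_eq_proj {m : ℕ} {ζ : Circle}
    (hζ : IsPrimitiveRoot (ζ : ℂ) (2 * m + 1)) {x : 𝒜} (hx : x ∈ gradedBand gr m) {n : ℤ}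
    (hn : n ∈ Finset.Icc (-(m : ℤ)) m) :
    ∑ j ∈ Finset.range (2 * m + 1), ((ζ : ℂ) ^ n) ^ j • gradedRotation gr (ζ ^ j) x =
      ((2 * m + 1 : ℕ) : ℂ) • GradedRing.proj gr n x := by
  refine Submodule.iSup_induction _ (motive := fun x =>
    ∑ j ∈ Finset.range (2 * m + 1), ((ζ : ℂ) ^ n) ^ j • gradedRotation gr (ζ ^ j) x =
      ((2 * m + 1 : ℕ) : ℂ) • GradedRing.proj gr n x) hx
    (fun i a ha => ?_) (by simp) fun a b ha hb => by
      simp only [map_add, smul_add, Finset.sum_add_distrib, ha, hb]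
  have hζ0 : (ζ : ℂ) ≠ 0 := Circle.coe_ne_zero ζ
  -- In degree `i` the rotation contributes `ζ ^ (-i * j)`, so the sum becomes geometric with ratio
  -- `ζ ^ (n - i)`.
  have hterm (j : ℕ) : ((ζ : ℂ) ^ n) ^ j • gradedRotation gr (ζ ^ j) a =
      ((ζ : ℂ) ^ (n - (i : ℤ))) ^ j • a := by
    rw [gradedRotation_of_mem gr _ ha, smul_smul, Circle.coe_pow, zpow_sub₀ hζ0, div_pow, zpow_neg,
      div_eq_mul_inv, ← zpow_natCast, ← zpow_natCast, ← zpow_natCast, ← zpow_mul, ← zpow_mul,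
      ← zpow_mul, mul_comm (j : ℤ) (i : ℤ)]
  simp only [hterm, ← Finset.sum_smul]
  rw [GradedRing.proj_apply]
  by_cases hni : n = i
  · subst hni
    rw [DirectSum.decompose_of_mem_same gr ha]
    simp
  · rw [DirectSum.decompose_of_mem_ne gr ha (Ne.symm hni), smul_zero]
    -- Two degrees in `[-m, m]` differ by at most `2 * m`, so the order `2 * m + 1` separates them
    -- and the geometric sum vanishes.
    have hne : (ζ : ℂ) ^ (n - (i : ℤ)) ≠ 1 := by
      rw [Ne, hζ.zpow_eq_one_iff_dvd]
      rintro ⟨c, hc⟩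
      have hi := Finset.mem_Icc.1 i.2
      have hn := Finset.mem_Icc.1 hn
      have hlt : |n - (i : ℤ)| < ((2 * m + 1 : ℕ) : ℤ) := by
        rw [abs_lt]
        push_cast
        omega
      exact hni (sub_eq_zero.1 (Int.eq_zero_of_abs_lt_dvd ⟨c, hc⟩ hlt))
    have hpow : ((ζ : ℂ) ^ (n - (i : ℤ))) ^ (2 * m + 1) = 1 := by
      rw [← zpow_natCast, ← zpow_mul, mul_comm, zpow_mul, zpow_natCast, hζ.pow_eq_one, one_zpow]
    rw [geom_sum_eq hne, hpow, sub_self, zero_div, zero_smul]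

end GradedBand

/-! ### Removing a linear factor by taking roots -/

/-- If `t > s > 0`, the powers of `t / s > 1` outgrow any linear function of the exponent, here
along the exponents `2 ^ j`. -/
theorem le_of_forall_pow_two_pow_le {s t C : ℝ} (hs : 0 ≤ s)
    (h : ∀ j : ℕ, t ^ 2 ^ j ≤ C * (2 ^ j : ℕ) * s ^ 2 ^ j) : t ≤ s := by
  by_contra! hst
  -- The ratio `t / s` needs `s ≠ 0`; for `s = 0` the case `j = 0` already gives `t ≤ 0`.
  rcases hs.eq_or_lt with rfl | hs
  · have := h 0
    simp at this
    linarith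
  have hr : 1 < t / s := (one_lt_div hs).2 hst
  have hlim : Filter.Tendsto (fun j : ℕ => C * (((2 ^ j : ℕ) : ℝ) ^ 1 / (t / s) ^ 2 ^ j))
      Filter.atTop (nhds (C * 0)) :=
    ((tendsto_pow_const_div_const_pow_of_one_lt 1 hr).comp
      (tendsto_pow_atTop_atTop_of_one_lt one_lt_two)).const_mul C
  rw [mul_zero] at hlim
  obtain ⟨j, hj⟩ := (hlim.eventually (gt_mem_nhds one_pos)).exists
  have h1 : 0 < (t / s) ^ 2 ^ j := by positivity
  rw [pow_one, ← mul_div_assoc, div_lt_one h1, div_pow, lt_div_iff₀ (by positivity)] at hj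
  exact absurd (h j) (not_le.2 hj)

/-! ### Comparison of circle invariant C⋆-norms -/

namespace CStarNorm

variable {𝒜 : Type*} [Ring 𝒜] [Algebra ℂ 𝒜] [StarRing 𝒜]
variable {gr : ℤ → Submodule ℂ 𝒜} [GradedAlgebra gr] {N N' : CStarNorm 𝒜}

theorem nonneg (N : CStarNorm 𝒜) (x : 𝒜) : 0 ≤ N x :=
  apply_nonneg N.toRingNorm x

theorem sum_le {ι : Type*} (N : CStarNorm 𝒜) (s : Finset ι) (f : ι → 𝒜) :
    N (∑ i ∈ s, f i) ≤ ∑ i ∈ s, N (f i) :=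
  norm_sum_le (E := N.Carrier) s f

/-- For self-adjoint elements the C⋆-identity says that squaring commutes with the norm; iterating
it reaches exactly the exponents `2 ^ j`. -/
theorem pow_two_pow_of_isSelfAdjoint (N : CStarNorm 𝒜) {x : 𝒜} (hx : IsSelfAdjoint x) (j : ℕ) :
    N (x ^ 2 ^ j) = N x ^ 2 ^ j := by
  induction j with
  | zero => simp
  | succ j ih =>
    have h := N.norm_star_mul_self' (x ^ 2 ^ j)
    rw [(hx.pow _).star_eq, ← pow_two, ← pow_mul, ← pow_succ] at h
    rw [h, ih, ← pow_mul, ← pow_succ]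

/-- The component is an average of unimodular multiples of rotated copies of `x`, none of norm
larger than `N x`. A finite average over roots of unity replaces the integral over the circle. -/
theorem proj_le_of_mem_gradedBand (hN : N.IsCircleInvariant gr) {m : ℕ} {x : 𝒜}
    (hx : x ∈ gradedBand gr m) {n : ℤ} (hn : n ∈ Finset.Icc (-(m : ℤ)) m) :
    N (GradedRing.proj gr n x) ≤ N x := by
  obtain ⟨ζ, hζ⟩ : ∃ ζ : Circle, IsPrimitiveRoot (ζ : ℂ) (2 * m + 1) := by
    refine ⟨Circle.exp (2 * Real.pi / (2 * m + 1 : ℕ)), ?_⟩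
    have h := Complex.isPrimitiveRoot_exp (2 * m + 1) (by omega)
    convert h using 1
    rw [Circle.coe_exp]
    push_cast
    congr 1
    ring
  have hM : (0 : ℝ) < (2 * m + 1 : ℕ) := by positivity
  refine le_of_mul_le_mul_left ?_ hM
  calc ((2 * m + 1 : ℕ) : ℝ) * N (GradedRing.proj gr n x)
      = N (((2 * m + 1 : ℕ) : ℂ) • GradedRing.proj gr n x) := by
        rw [N.norm_smul', Complex.norm_natCast]
    _ = N (∑ j ∈ Finset.range (2 * m + 1),
          ((ζ : ℂ) ^ n) ^ j • gradedRotation gr (ζ ^ j) x) := by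
        rw [sum_gradedRotation_eq_proj hζ hx hn]
    _ ≤ ∑ j ∈ Finset.range (2 * m + 1),
          N (((ζ : ℂ) ^ n) ^ j • gradedRotation gr (ζ ^ j) x) := N.sum_le _ _
    _ ≤ ∑ j ∈ Finset.range (2 * m + 1), N x := by
        refine Finset.sum_le_sum fun j _ => ?_
        rw [N.norm_smul', norm_pow, norm_zpow, Circle.norm_coe, one_zpow, one_pow, one_mul]
        exact hN _ x
    _ = ((2 * m + 1 : ℕ) : ℝ) * N x := by simp

/-- C⋆-norms that agree in degree zero agree on homogeneous elements. -/
theorem eq_of_mem (hstar : ∀ (n : ℤ) (x : 𝒜), x ∈ gr n → star x ∈ gr (-n))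
    (hzero : ∀ x ∈ gr 0, N x = N' x) {n : ℤ} {x : 𝒜} (hx : x ∈ gr n) : N x = N' x := by
  have hmem : star x * x ∈ gr 0 := by
    simpa using SetLike.mul_mem_graded (hstar n x hx) hx
  have h := hzero _ hmem
  rw [N.norm_star_mul_self', N'.norm_star_mul_self'] at h
  exact (pow_left_inj₀ (N.nonneg x) (N'.nonneg x) two_ne_zero).1 h

/-- There are at most `2 * m + 1` components; on each the norms agree, and each is bounded by `N'
x`. -/
theorem le_mul_of_mem_gradedBand (hstar : ∀ (n : ℤ) (x : 𝒜), x ∈ gr n → star x ∈ gr (-n))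
    (hN' : N'.IsCircleInvariant gr) (hzero : ∀ x ∈ gr 0, N x = N' x) {m : ℕ} {x : 𝒜}
    (hx : x ∈ gradedBand gr m) : N x ≤ (2 * m + 1) * N' x := by
  calc N x = N (∑ n ∈ Finset.Icc (-(m : ℤ)) m, GradedRing.proj gr n x) := by
        rw [sum_proj_eq_of_mem_gradedBand hx]
    _ ≤ ∑ n ∈ Finset.Icc (-(m : ℤ)) m, N (GradedRing.proj gr n x) := N.sum_le _ _
    _ ≤ ∑ n ∈ Finset.Icc (-(m : ℤ)) m, N' x := by
        refine Finset.sum_le_sum fun n hn => ?_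
        rw [eq_of_mem hstar hzero (n := n) (by rw [GradedRing.proj_apply]; exact Subtype.property _)]
        exact proj_le_of_mem_gradedBand hN' hx hn
    _ = (2 * m + 1) * N' x := by
        rw [Finset.sum_const, Int.card_Icc, nsmul_eq_mul,
          show ((m : ℤ) + 1 - -(m : ℤ)).toNat = 2 * m + 1 by omega]
        push_cast
        ring

theorem le_of_eq_on_zero (hstar : ∀ (n : ℤ) (x : 𝒜), x ∈ gr n → star x ∈ gr (-n))
    (hN' : N'.IsCircleInvariant gr) (hzero : ∀ x ∈ gr 0, N x = N' x) (x : 𝒜) : N x ≤ N' x := by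
  obtain ⟨m, hm⟩ := exists_mem_gradedBand gr (star x * x)
  have hself : IsSelfAdjoint (star x * x) := IsSelfAdjoint.star_mul_self x
  have h : N (star x * x) ≤ N' (star x * x) := by
    refine le_of_forall_pow_two_pow_le (C := 2 * m + 1) (N'.nonneg _) fun j => ?_
    rw [← N.pow_two_pow_of_isSelfAdjoint hself, ← N'.pow_two_pow_of_isSelfAdjoint hself]
    refine (le_mul_of_mem_gradedBand hstar hN' hzero (pow_mem_gradedBand hm _)).trans ?_
    refine mul_le_mul_of_nonneg_right ?_ (N'.nonneg _)
    -- Absorbs the `1` of the band width: `2 * (2 ^ j * m) + 1 ≤ (2 * m + 1) * 2 ^ j`.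
    have h1 : (1 : ℝ) ≤ (2 ^ j : ℕ) := by exact_mod_cast Nat.one_le_two_pow
    rw [Nat.cast_mul]
    nlinarith
  rw [N.norm_star_mul_self', N'.norm_star_mul_self'] at h
  exact (pow_le_pow_iff_left₀ (N.nonneg x) (N'.nonneg x) two_ne_zero).1 h

theorem ext_toFun (h : ∀ x, N x = N' x) : N = N' := by
  obtain ⟨n, _, _⟩ := N
  obtain ⟨n', _, _⟩ := N'
  obtain rfl : n = n' := RingNorm.ext h
  rfl

/-- A circle invariant C⋆-norm on a `ℤ`-graded ⋆-algebra is determined by its restriction to the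
component of degree zero. -/
theorem eq_of_eq_on_zero (hstar : ∀ (n : ℤ) (x : 𝒜), x ∈ gr n → star x ∈ gr (-n))
    (hN : N.IsCircleInvariant gr) (hN' : N'.IsCircleInvariant gr)
    (hzero : ∀ x ∈ gr 0, N x = N' x) : N = N' :=
  ext_toFun fun x => le_antisymm (le_of_eq_on_zero hstar hN' hzero x)
    (le_of_eq_on_zero hstar hN (fun y hy => (hzero y hy).symm) x)

end CStarNorm

theorem theoremt {𝒜 : Type*} [Ring 𝒜] [Algebra ℂ 𝒜] [StarRing 𝒜] [StarModule ℂ 𝒜]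
    (gr : ℤ → Submodule ℂ 𝒜) [GradedAlgebra gr]
    (hstar : ∀ (n : ℤ) (x : 𝒜), x ∈ gr n → star x ∈ gr (-n))
    (N N' : CStarNorm 𝒜)
    (hN : N.IsCircleInvariant gr) (hN' : N'.IsCircleInvariant gr)
    (hzero : ∀ x ∈ gr 0, N x = N' x) :
    ((CStarNorm.circleAction hstar hN).FullSpectral ↔
        (CStarNorm.circleAction hstar hN').FullSpectral) ∧
      ((CStarNorm.circleAction hstar hN).FullSpectral →
        (∃ Φ : N.Completion ≃⋆ₐ[ℂ] N'.Completion,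
            ∀ x : 𝒜, Φ (N.toCompletion x) = N'.toCompletion x) ∧
          ∀ x : 𝒜, N x = N' x) := by
  -- Equality of the norms as structures makes the completions and actions literally the same, so
  -- the equivalence is trivial and the isomorphism is the identity.
  obtain rfl : N = N' := CStarNorm.eq_of_eq_on_zero hstar hN hN' hzero
  exact ⟨Iff.rfl, fun _ => ⟨⟨StarAlgEquiv.refl ℂ N.Completion, fun _ => rfl⟩, fun _ => rfl⟩⟩
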